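/- All graphs are finite and simple. A graph is planar if it can be drawn in the plane with vertices as distinct points and edges as (polygonal) arcs that meet only in common ends. For a graph $H$, an orientation of its edges, an Abelian group $A$ and $f\colon E(H)\to A$, an $(A,f)$-coloring is a map $c\colon V(H)\to A$ with $c(u)-c(v)\neq f(uv)$ for every edge $uv$ directed from $u$ to $v$. The graph $H$ is $A$-colorable if it has an $(A,f)$-coloring for every $f$ (under every orientation; the choice of orientation is immaterial). It is group $k$-choosable if for every Abelian group $A$ with $|A|\ge k$, every assignment of lists $L(v)\subseteq A$ with $|L(v)|=k$, and every $f\colon E(H)\to A$, it has an $(A,f)$-coloring $c$ with $c(v)\in L(v)$ for all $v$. Let $\chi_g(H)$ be the least $m$ such that $H$ is $A$-colorable for every Abelian group $A$ with $|A|\ge m$, and let $\chi_{gl}(H)$ be the least $k$ such that $H$ is group $k$-choosable. With $\mathcal L(G)$ the line graph of $G$, put $\chi'_g(G)=\chi_g(\mathcal L(G))$ and $\chi'_{gl}(G)=\chi_{gl}(\mathcal L(G))$. **Theorem.** Let $\Delta\ge 3$ be an integer and let $G$ be a planar graph with maximum degree $\Delta(G)\ge\Delta$. If the girth of $G$ (the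 length of a shortest cycle, $+\infty$ if $G$ is a forest) satisfies $$g(G)\ \ge\ 4+\left\lceil\frac{8}{\Delta-2}\right\rceil,$$ then $\chi'_g(G)=\chi'_{gl}(G)=\Delta(G)$. -/

import Mathlib

universe u w

namespace SimpleGraph

/-! ### Group colorings -/

/-- An orientation of the edges of `G`: `D.Dir u v` says that `uv` is an edge directed from `u`
to `v`. Every edge gets exactly one of its two directions. -/
structure EdgeOrientation {V : Type u} (G : SimpleGraph V) where
  Dir : V → V → Prop
  adj_of_dir : ∀ {u v : V}, Dir u v → G.Adj u v
  dir_or_dir : ∀ {u v : V}, G.Adj u v → Dir u v ∨ Dir v u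
  asymm : ∀ {u v : V}, Dir u v → ¬ Dir v u

/-- `c` is an `(A, f)`-coloring of `G` under the orientation `D`: `c u - c v ≠ f (uv)` for every
edge `uv` directed from `u` to `v`. -/
def IsGroupColoring {V : Type u} {G : SimpleGraph V} {A : Type w} [AddCommGroup A]
    (D : G.EdgeOrientation) (f : G.edgeSet → A) (c : V → A) : Prop :=
  ∀ (u v : V) (h : D.Dir u v), c u - c v ≠ f ⟨s(u, v), D.adj_of_dir h⟩

/-- `G` is `A`-colorable: under every orientation `D`, and for every `f : E(G) → A`, there is an
`(A, f)`-coloring. -/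
def IsGroupColorable {V : Type u} (G : SimpleGraph V) (A : Type w) [AddCommGroup A] : Prop :=
  ∀ (D : G.EdgeOrientation) (f : G.edgeSet → A), ∃ c : V → A, IsGroupColoring D f c

/-- `G` is group `k`-choosable: for every Abelian group `A` of order at least `k` (possibly
infinite), every `k`-uniform list assignment `L`, every orientation `D` and every `f : E(G) → A`
there is an `(A, f)`-coloring `c` with `c v ∈ L v` for all vertices `v`. -/
def IsGroupChoosable {V : Type u} (G : SimpleGraph V) (k : ℕ) : Prop :=
  ∀ (A : Type w) [AddCommGroup A], (k : ℕ∞) ≤ ENat.card A →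
    ∀ L : V → Finset A, (∀ v, (L v).card = k) →
      ∀ (D : G.EdgeOrientation) (f : G.edgeSet → A),
        ∃ c : V → A, IsGroupColoring D f c ∧ ∀ v, c v ∈ L v

/-- The group chromatic number: the least `m` such that `G` is `A`-colorable for every Abelian
group `A` of order at least `m` (and `⊤` if there is no such `m`). -/
noncomputable def groupChromaticNumber {V : Type u} (G : SimpleGraph V) : ℕ∞ :=
  ⨅ m ∈ {m : ℕ | ∀ (A : Type w) [AddCommGroup A],
    (m : ℕ∞) ≤ ENat.card A → G.IsGroupColorable A}, (m : ℕ∞)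

/-- The group choice number: the least `k` such that `G` is group `k`-choosable (and `⊤` if there
is no such `k`). -/
noncomputable def groupChoiceNumber {V : Type u} (G : SimpleGraph V) : ℕ∞ :=
  ⨅ k ∈ {k : ℕ | IsGroupChoosable.{u, w} G k}, (k : ℕ∞)

/-- The group edge chromatic number: the group chromatic number of the line graph. -/
noncomputable def groupEdgeChromaticNumber {V : Type u} (G : SimpleGraph V) : ℕ∞ :=
  groupChromaticNumber.{u, w} G.lineGraph

/-- The group edge choice number: the group choice number of the line graph. -/
noncomputable def groupEdgeChoiceNumber {V : Type u} (G : SimpleGraph V) : ℕ∞ :=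
  groupChoiceNumber.{u, w} G.lineGraph

/-! ### Planar graphs -/

/-- `P` is a (polygonal) arc in the plane with ends `x` and `y`: the union of the segments
`[p₀, p₁], …, [pₙ₋₁, pₙ]` of a polygonal chain from `p₀ = x` to `pₙ = y` with `n ≥ 1` that does not
meet itself, i.e. consecutive segments share only their common corner and all other pairs of
segments are disjoint. -/
def IsPolygonalArc (P : Set (ℝ × ℝ)) (x y : ℝ × ℝ) : Prop :=
  ∃ (n : ℕ) (p : ℕ → ℝ × ℝ), 0 < n ∧ p 0 = x ∧ p n = y ∧
    Set.InjOn p (Set.Iic n) ∧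
    (∀ i, i + 1 < n →
      segment ℝ (p i) (p (i + 1)) ∩ segment ℝ (p (i + 1)) (p (i + 2)) = {p (i + 1)}) ∧
    (∀ i j, i + 1 < j → j < n →
      Disjoint (segment ℝ (p i) (p (i + 1))) (segment ℝ (p j) (p (j + 1)))) ∧
    P = ⋃ i ∈ Set.Iio n, segment ℝ (p i) (p (i + 1))

/-- A drawing of `G` in the plane without crossings: the vertices are distinct points, every edge
is an arc between its two ends that contains no other vertex, and two different edges meet only in
common ends. -/
structure PlaneDrawing {V : Type u} (G : SimpleGraph V) where
  point : V → ℝ × ℝ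
  point_injective : Function.Injective point
  arc : G.edgeSet → Set (ℝ × ℝ)
  isPolygonalArc : ∀ (u v : V) (h : G.Adj u v),
    IsPolygonalArc (arc ⟨s(u, v), h⟩) (point u) (point v)
  mem_of_point_mem : ∀ (e : G.edgeSet) (v : V), point v ∈ arc e → v ∈ (e : Sym2 V)
  inter_subset : ∀ e e' : G.edgeSet, e ≠ e' → ∀ q ∈ arc e ∩ arc e',
    ∃ v : V, v ∈ (e : Sym2 V) ∧ v ∈ (e' : Sym2 V) ∧ q = point v

/-- A graph is planar if it can be drawn in the plane without crossings. -/
def IsPlanar {V : Type u} (G : SimpleGraph V) : Prop :=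
  Nonempty G.PlaneDrawing

end SimpleGraph

/-! Upper bound: every nonempty set `S` of edges contains an edge adjacent to fewer than `Δ(G)`
others in `S` (`card_lineGraph_neighbors_lt`). Coloring that edge last, each colored neighbor
forbids one element of its list, so greedy coloring succeeds (`isGroupChoosable_of_degenerate`).
Lower bound: the edges at a vertex of maximum degree form a clique of the line graph, and with `f =
0` their colors differ.

The light edge comes from counting. Let `H` be the subgraph with edge set `S`, with `m` edges and
`n` non-isolated vertices, and put `k = Δ(G)`. If every edge had degree sum at least `k + 2`, then
`1/deg x + 1/deg y ≤ (k+2)/(2k)` on each edge, so `2kn ≤ (k+2)m`. Since `4 + 8/(d-2) = 4d/(d-2)`,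
this contradicts Euler's inequality `(m - n + 2)g ≤ 2m`.

Euler's inequality is proved algebraically, without the Jordan curve theorem. The cycle space over
`ZMod 2` of a plane graph is spanned by cycles covering each edge at most twice
(`PlaneDrawing.hasTwofoldSpan`). A basis chosen among them, together with its sum, still covers each
edge at most twice, and each of these `r + 1` nonzero elements has at least `g` edges; finally `r ≥
m - n + 1`.

The spanning cycles are face boundaries in disguise. After cutting arcs into segments and shearing,
each side of a segment is labelled by the function sending a cycle `C` to the parity of the number
of segments of `C` below that side. Sides with equal labels count as lying on the same face. -/

/-! ### Systems of non-crossing segments -/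

/-- A family of non-vertical segments in the plane, given by their left and right ends, such that
different ends have different first coordinates and two different segments meet only in common
ends. -/
structure SegmentSystem (E : Type*) where
  left : E → ℝ × ℝ
  right : E → ℝ × ℝ
  left_lt_right : ∀ e, (left e).1 < (right e).1
  eq_of_fst_eq : ∀ e e' p p', (p = left e ∨ p = right e) → (p' = left e' ∨ p' = right e') →
    p.1 = p'.1 → p = p'
  end_of_mem : ∀ e e', e ≠ e' → ∀ z, z ∈ segment ℝ (left e) (right e) →
    z ∈ segment ℝ (left e') (right e') → z = left e ∨ z = right e

namespace SegmentSystem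

variable {E : Type*} (S : SegmentSystem E)

/-- The slope of a segment. -/
noncomputable def slope (e : E) : ℝ :=
  ((S.right e).2 - (S.left e).2) / ((S.right e).1 - (S.left e).1)

/-- The second coordinate of the point of the line through a segment above the abscissa `x`. -/
noncomputable def height (e : E) (x : ℝ) : ℝ :=
  (S.left e).2 + S.slope e * (x - (S.left e).1)

theorem height_left (e : E) : S.height e (S.left e).1 = (S.left e).2 := by
  simp [height]

theorem height_right (e : E) : S.height e (S.right e).1 = (S.right e).2 := by
  have := S.left_lt_right e
  have h : (S.right e).1 - (S.left e).1 ≠ 0 := by linarith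
  simp only [height, slope]
  field_simp
  ring

theorem mem_segment (e : E) {x : ℝ} (h₁ : (S.left e).1 ≤ x) (h₂ : x ≤ (S.right e).1) :
    (x, S.height e x) ∈ segment ℝ (S.left e) (S.right e) := by
  have h := S.left_lt_right e
  have h' : 0 < (S.right e).1 - (S.left e).1 := by linarith
  rw [segment_eq_image]
  refine ⟨(x - (S.left e).1) / ((S.right e).1 - (S.left e).1), ⟨div_nonneg (by linarith) h'.le, ?_⟩, ?_⟩
  · rw [div_le_one h']; linarith
  · ext
    · simp only [Prod.fst_add, Prod.smul_fst, smul_eq_mul]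
      field_simp
      ring
    · simp only [Prod.snd_add, Prod.smul_snd, smul_eq_mul, height, slope]
      field_simp
      ring

theorem fst_eq_of_height_eq {e e' : E} (hne : e ≠ e') {x : ℝ}
    (h₁ : (S.left e).1 ≤ x) (h₂ : x ≤ (S.right e).1)
    (h₁' : (S.left e').1 ≤ x) (h₂' : x ≤ (S.right e').1) (h : S.height e x = S.height e' x) :
    x = (S.left e).1 ∨ x = (S.right e).1 := by
  have hm := S.mem_segment e h₁ h₂
  have hm' := S.mem_segment e' h₁' h₂'
  rw [← h] at hm'
  rcases S.end_of_mem e e' hne _ hm hm' with h | h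
  · exact Or.inl (congrArg Prod.fst h)
  · exact Or.inr (congrArg Prod.fst h)

/-- `S.Below e' e` says that `e'` runs below `e` over a common open interval of abscissae. -/
def Below (e' e : E) : Prop :=
  ∃ x, (S.left e).1 < x ∧ x < (S.right e).1 ∧ (S.left e').1 < x ∧ x < (S.right e').1 ∧
    S.height e' x < S.height e x

theorem Below.ne {S : SegmentSystem E} {e' e : E} (h : S.Below e' e) : e ≠ e' := by
  rintro rfl
  obtain ⟨x, -, -, -, -, h⟩ := h
  exact lt_irrefl _ h

/-- If the order were reversed at `x`, the intermediate value theorem would give a common point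
strictly inside one of the segments. -/
theorem Below.height_le {S : SegmentSystem E} {e' e : E} (h : S.Below e' e) {x : ℝ}
    (h₁ : (S.left e).1 ≤ x) (h₂ : x ≤ (S.right e).1)
    (h₁' : (S.left e').1 ≤ x) (h₂' : x ≤ (S.right e').1) : S.height e' x ≤ S.height e x := by
  have hne := h.ne
  obtain ⟨y, a, b, a', b', hy⟩ := h
  by_contra! hx
  have hc : ContinuousOn (fun t => S.height e t - S.height e' t) (Set.uIcc x y) := by
    unfold height; fun_prop
  have h0 : (0 : ℝ) ∈ Set.uIcc (S.height e x - S.height e' x) (S.height e y - S.height e' y) :=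
    Set.mem_uIcc.2 (Or.inl ⟨by linarith, by linarith⟩)
  obtain ⟨z, hz, hz0⟩ := intermediate_value_uIcc hc h0
  have hz0' : S.height e z = S.height e' z := by simpa [sub_eq_zero] using hz0
  have hzx : z ≠ x := by rintro rfl; linarith
  rcases Set.mem_uIcc.1 hz with ⟨k₁, k₂⟩ | ⟨k₁, k₂⟩
  · have k₃ := lt_of_le_of_ne k₁ hzx.symm
    rcases S.fst_eq_of_height_eq hne (by linarith) (by linarith) (by linarith) (by linarith) hz0'
      with h | h <;> linarith
  · have k₃ := lt_of_le_of_ne k₂ hzx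
    rcases S.fst_eq_of_height_eq hne (by linarith) (by linarith) (by linarith) (by linarith) hz0'
      with h | h <;> linarith

theorem Below.height_lt {S : SegmentSystem E} {e' e : E} (h : S.Below e' e) {x : ℝ}
    (h₁ : (S.left e).1 ≤ x) (h₂ : x ≤ (S.right e).1)
    (h₁' : (S.left e').1 ≤ x) (h₂' : x ≤ (S.right e').1)
    (hx : ((S.left e).1 < x ∧ x < (S.right e).1) ∨ ((S.left e').1 < x ∧ x < (S.right e').1)) :
    S.height e' x < S.height e x := by
  refine lt_of_le_of_ne (h.height_le h₁ h₂ h₁' h₂') fun hh => ?_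
  rcases hx with ⟨k₁, k₂⟩ | ⟨k₁, k₂⟩
  · rcases S.fst_eq_of_height_eq h.ne h₁ h₂ h₁' h₂' hh.symm with h | h <;> linarith
  · rcases S.fst_eq_of_height_eq h.ne.symm h₁' h₂' h₁ h₂ hh with h | h <;> linarith

/-- The abscissa `x` may be an end. At an interior abscissa of the overlap, equality is a forbidden
crossing and the reverse order contradicts `Below.height_le`. -/
theorem below_of_height_lt {e' e : E} {x : ℝ}
    (h₁ : (S.left e).1 ≤ x) (h₂ : x ≤ (S.right e).1)
    (h₁' : (S.left e').1 ≤ x) (h₂' : x ≤ (S.right e').1)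
    (ho : (S.left e).1 < (S.right e').1) (ho' : (S.left e').1 < (S.right e).1)
    (hx : S.height e' x < S.height e x) : S.Below e' e := by
  have hl := S.left_lt_right e
  have hl' := S.left_lt_right e'
  obtain ⟨y, hy₁, hy₂⟩ := exists_between
    (max_lt (lt_min hl ho) (lt_min ho' hl') :
      max (S.left e).1 (S.left e').1 < min (S.right e).1 (S.right e').1)
  obtain ⟨a, a'⟩ := max_lt_iff.1 hy₁
  obtain ⟨b, b'⟩ := lt_min_iff.1 hy₂
  have hne : e ≠ e' := by rintro rfl; exact lt_irrefl _ hx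
  rcases lt_trichotomy (S.height e' y) (S.height e y) with h | h | h
  · exact ⟨y, a, b, a', b', h⟩
  · rcases S.fst_eq_of_height_eq hne a.le b.le a'.le b'.le h.symm with h | h <;> linarith
  · have : S.Below e e' := ⟨y, a', b', a, b, h⟩
    have := this.height_le h₁' h₂' h₁ h₂
    linarith

/-- The point `p` lies strictly below the interior of the segment `e`. -/
def PointBelow (e : E) (p : ℝ × ℝ) : Prop :=
  (S.left e).1 < p.1 ∧ p.1 < (S.right e).1 ∧ p.2 < S.height e p.1

/-- The segment `e` passes strictly below the point `p`. -/
def PassesBelow (p : ℝ × ℝ) (e : E) : Prop :=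
  (S.left e).1 < p.1 ∧ p.1 < (S.right e).1 ∧ S.height e p.1 < p.2

theorem pointBelow_left_iff (e e' : E) :
    S.PointBelow e (S.left e') ↔ S.Below e' e ∧ (S.left e).1 < (S.left e').1 := by
  have hl' := S.left_lt_right e'
  constructor
  · rintro ⟨h₁, h₂, h₃⟩
    rw [← S.height_left e'] at h₃
    exact ⟨S.below_of_height_lt h₁.le h₂.le le_rfl hl'.le (h₁.trans hl') h₂ h₃, h₁⟩
  · rintro ⟨hb, h₁⟩
    obtain ⟨y, a, b, a', b', -⟩ := id hb
    have h₂ := a'.trans b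
    refine ⟨h₁, h₂, ?_⟩
    have := hb.height_lt h₁.le h₂.le le_rfl hl'.le (Or.inl ⟨h₁, h₂⟩)
    rwa [S.height_left] at this

theorem pointBelow_right_iff (e e' : E) :
    S.PointBelow e (S.right e') ↔ S.Below e' e ∧ (S.right e').1 < (S.right e).1 := by
  have hl' := S.left_lt_right e'
  constructor
  · rintro ⟨h₁, h₂, h₃⟩
    rw [← S.height_right e'] at h₃
    exact ⟨S.below_of_height_lt h₁.le h₂.le hl'.le le_rfl h₁ (hl'.trans h₂) h₃, h₂⟩
  · rintro ⟨hb, h₂⟩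
    obtain ⟨y, a, b, a', b', -⟩ := id hb
    have h₁ := a.trans b'
    refine ⟨h₁, h₂, ?_⟩
    have := hb.height_lt h₁.le h₂.le hl'.le le_rfl (Or.inl ⟨h₁, h₂⟩)
    rwa [S.height_right] at this

theorem height_eq_left (e : E) (x : ℝ) :
    S.height e x = (S.left e).2 + S.slope e * (x - (S.left e).1) := rfl

theorem height_eq_right (e : E) (x : ℝ) :
    S.height e x = (S.right e).2 + S.slope e * (x - (S.right e).1) := by
  rw [← S.height_right e, height_eq_left, height_eq_left]
  ring

/-- Splits the segments counted at the left end `p` of `e` into those missing `p`, a set depending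
on `p` alone, and the lower part of the fan of segments that start at `p`. -/
theorem below_and_left_le_iff (e e' : E) :
    (S.Below e' e ∧ (S.left e').1 ≤ (S.left e).1) ↔
      S.PassesBelow (S.left e) e' ∨ (S.left e' = S.left e ∧ S.slope e' < S.slope e) := by
  have hl := S.left_lt_right e
  have hl' := S.left_lt_right e'
  constructor
  · rintro ⟨hb, hle⟩
    obtain ⟨y, a, b, a', b', hy⟩ := id hb
    rcases hle.lt_or_eq with hlt | heq
    · have := hb.height_lt le_rfl hl.le hle (a.trans b').le (Or.inr ⟨hlt, a.trans b'⟩)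
      rw [S.height_left] at this
      exact Or.inl ⟨hlt, a.trans b', this⟩
    · have hp := S.eq_of_fst_eq e' e _ _ (Or.inl rfl) (Or.inl rfl) heq
      refine Or.inr ⟨hp, ?_⟩
      rw [height_eq_left, height_eq_left, hp] at hy
      have : 0 < y - (S.left e).1 := by linarith
      exact lt_of_mul_lt_mul_right (by linarith) this.le
  · rintro (⟨h₁, h₂, h₃⟩ | ⟨hp, hs⟩)
    · rw [← S.height_left e] at h₃
      exact ⟨S.below_of_height_lt le_rfl hl.le h₁.le h₂.le h₂ (h₁.trans hl) h₃, h₁.le⟩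
    · refine ⟨?_, by rw [hp]⟩
      rw [hp] at hl'
      obtain ⟨y, hy₁, hy₂⟩ := exists_between (lt_min hl hl')
      obtain ⟨b, b'⟩ := lt_min_iff.1 hy₂
      refine ⟨y, hy₁, b, by rwa [hp], b', ?_⟩
      rw [height_eq_left, height_eq_left, hp]
      have : 0 < y - (S.left e).1 := by linarith
      nlinarith

theorem below_and_le_right_iff (e e' : E) :
    (S.Below e' e ∧ (S.right e).1 ≤ (S.right e').1) ↔
      S.PassesBelow (S.right e) e' ∨ (S.right e' = S.right e ∧ S.slope e < S.slope e') := by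
  have hl := S.left_lt_right e
  have hl' := S.left_lt_right e'
  constructor
  · rintro ⟨hb, hle⟩
    obtain ⟨y, a, b, a', b', hy⟩ := id hb
    rcases hle.lt_or_eq with hlt | heq
    · have := hb.height_lt hl.le le_rfl (a'.trans b).le hle (Or.inr ⟨a'.trans b, hlt⟩)
      rw [S.height_right] at this
      exact Or.inl ⟨a'.trans b, hlt, this⟩
    · have hp := S.eq_of_fst_eq e' e _ _ (Or.inr rfl) (Or.inr rfl) heq.symm
      refine Or.inr ⟨hp, ?_⟩
      rw [height_eq_right, height_eq_right, hp] at hy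
      have : 0 < (S.right e).1 - y := by linarith
      exact lt_of_mul_lt_mul_right (by linarith) this.le
  · rintro (⟨h₁, h₂, h₃⟩ | ⟨hp, hs⟩)
    · rw [← S.height_right e] at h₃
      exact ⟨S.below_of_height_lt hl.le le_rfl h₁.le h₂.le (hl.trans h₂) h₁ h₃, h₂.le⟩
    · refine ⟨?_, by rw [hp]⟩
      rw [hp] at hl'
      obtain ⟨y, hy₁, hy₂⟩ := exists_between (max_lt hl hl')
      obtain ⟨b, b'⟩ := max_lt_iff.1 hy₁
      refine ⟨y, b, hy₂, b', by rwa [hp], ?_⟩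
      rw [height_eq_right, height_eq_right, hp]
      have : 0 < (S.right e).1 - y := by linarith
      nlinarith

theorem eq_of_left_eq_of_slope_eq {e e' : E} (hp : S.left e = S.left e')
    (hs : S.slope e = S.slope e') : e = e' := by
  by_contra hne
  have hl := S.left_lt_right e
  have hl' := S.left_lt_right e'
  rw [← hp] at hl'
  obtain ⟨y, hy₁, hy₂⟩ := exists_between (lt_min hl hl')
  obtain ⟨b, b'⟩ := lt_min_iff.1 hy₂
  rcases S.fst_eq_of_height_eq hne hy₁.le b.le (hp ▸ hy₁.le) b'.le
    (by rw [height_eq_left, height_eq_left, hp, hs]) with h | h <;> linarith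

theorem eq_of_right_eq_of_slope_eq {e e' : E} (hp : S.right e = S.right e')
    (hs : S.slope e = S.slope e') : e = e' := by
  by_contra hne
  have hl := S.left_lt_right e
  have hl' := S.left_lt_right e'
  rw [← hp] at hl'
  obtain ⟨y, hy₁, hy₂⟩ := exists_between (max_lt hl hl')
  obtain ⟨b, b'⟩ := max_lt_iff.1 hy₁
  rcases S.fst_eq_of_height_eq hne b.le hy₂.le b'.le (hp ▸ hy₂.le)
    (by rw [height_eq_right, height_eq_right, hp, hs]) with h | h <;> linarith

end SegmentSystem

/-! ### Face boundaries of a system of segments -/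

section CycleSpace

variable {E P : Type*}

/-- The cycle space over `ZMod 2` of an incidence matrix `inc`. -/
def cycleSpace [Fintype E] (inc : P → E → ZMod 2) : Submodule (ZMod 2) (E → ZMod 2) where
  carrier := {C | ∀ p, ∑ e, inc p e * C e = 0}
  add_mem' {C D} hC hD p := by
    simp only [Pi.add_apply, mul_add, Finset.sum_add_distrib]
    rw [hC p, hD p, add_zero]
  zero_mem' p := by simp
  smul_mem' a C hC p := by
    simp only [Pi.smul_apply, smul_eq_mul, mul_left_comm _ a]
    rw [← Finset.mul_sum, hC p, mul_zero]

theorem mem_cycleSpace [Fintype E] {inc : P → E → ZMod 2} {C : E → ZMod 2} :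
    C ∈ cycleSpace inc ↔ ∀ p, ∑ e, inc p e * C e = 0 := Iff.rfl

/-- A space of `ZMod 2`-valued functions has a twofold spanning family if it is spanned by finitely
many of its elements such that every point is in the support of at most two of them. -/
def HasTwofoldSpan (Z : Submodule (ZMod 2) (E → ZMod 2)) : Prop :=
  ∃ (n : ℕ) (b : Fin n → E → ZMod 2), (∀ i, b i ∈ Z) ∧
    (∀ e, (Finset.univ.filter fun i => b i e ≠ 0).card ≤ 2) ∧
    Z ≤ Submodule.span (ZMod 2) (Set.range b)

theorem HasTwofoldSpan.of_fintype {Z : Submodule (ZMod 2) (E → ZMod 2)} {ι : Type*} [Fintype ι]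
    (b : ι → E → ZMod 2) (hb : ∀ i, b i ∈ Z)
    (h2 : ∀ e, (Finset.univ.filter fun i => b i e ≠ 0).card ≤ 2)
    (hs : Z ≤ Submodule.span (ZMod 2) (Set.range b)) : HasTwofoldSpan Z := by
  refine ⟨Fintype.card ι, b ∘ (Fintype.equivFin ι).symm, fun i => hb _, fun e => ?_, ?_⟩
  · refine le_trans (Finset.card_le_card_of_injOn (Fintype.equivFin ι).symm ?_
      (Fintype.equivFin ι).symm.injective.injOn) (h2 e)
    intro i hi
    simpa using hi
  · rwa [(Fintype.equivFin ι).symm.surjective.range_comp]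

end CycleSpace

/-- Sort `R` by `σ`: the label above one element is the label below the next, so modulo 2 all inner
terms cancel and only the two extreme labels remain. This is used for going once through the fan at
a point. -/
theorem sum_telescope_of_injOn {ι M : Type*} [AddCommMonoid M] (R : Finset ι)
    (σ : ι → ℝ) (hσ : Set.InjOn σ R) (χ : ι → M) (β : M) (g : M → ZMod 2) :
    ∑ e ∈ R, (g (β + ∑ e' ∈ R with σ e' < σ e, χ e') +
      g (β + ∑ e' ∈ R with σ e' < σ e, χ e' + χ e)) = g β + g (β + ∑ e ∈ R, χ e) := by
  classical
  induction R using Finset.induction_on_max_value σ with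
  | empty => simp [CharTwo.add_self_eq_zero]
  | insert a s ha hmax ih =>
    have hlt : ∀ x ∈ s, σ x < σ a := fun x hx => lt_of_le_of_ne (hmax x hx) fun h =>
      ha (hσ (by simp [hx]) (by simp) h ▸ hx)
    rw [Finset.sum_insert ha, Finset.sum_insert ha]
    have h₁ : (insert a s).filter (fun e' => σ e' < σ a) = s := by
      ext x
      simp only [Finset.mem_filter, Finset.mem_insert]
      constructor
      · rintro ⟨rfl | h, h'⟩
        · exact absurd h' (lt_irrefl _)
        · exact h
      · exact fun h => ⟨Or.inr h, hlt x h⟩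
    have h₂ : ∀ e ∈ s, (insert a s).filter (fun e' => σ e' < σ e) =
        s.filter (fun e' => σ e' < σ e) := by
      intro e he
      rw [Finset.filter_insert, if_neg (hlt e he).le.not_gt]
    have h₃ := ih (hσ.mono (by simp [Set.subset_insert]))
    rw [Finset.sum_congr rfl fun e he => by rw [← h₂ e he]] at h₃
    rw [h₁, h₃, add_assoc β, add_comm (χ a)]
    generalize g (β + ∑ e ∈ s, χ e) = t
    rw [add_comm t, add_comm (g β) t, add_assoc, ← add_assoc t t, CharTwo.add_self_eq_zero,
      zero_add, add_comm]

namespace SegmentSystem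

open Classical in
/-- The incidence matrix of ends and segments. -/
noncomputable def inc {E : Type*} (S : SegmentSystem E) (p : ℝ × ℝ) (e : E) : ZMod 2 :=
  (if S.left e = p then 1 else 0) + (if S.right e = p then 1 else 0)

variable {E : Type*} [Fintype E] (S : SegmentSystem E)

/-- Cycles are orthogonal to coboundaries. -/
theorem sum_ends_mul_eq_zero {C : E → ZMod 2} (hC : C ∈ cycleSpace S.inc)
    (g : ℝ × ℝ → ZMod 2) : ∑ e, (g (S.left e) + g (S.right e)) * C e = 0 := by
  classical
  let P : Finset (ℝ × ℝ) := Finset.univ.image S.left ∪ Finset.univ.image S.right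
  have h : ∀ e, g (S.left e) + g (S.right e) = ∑ p ∈ P, g p * S.inc p e := by
    intro e
    simp only [inc, mul_add, Finset.sum_add_distrib, mul_ite, mul_one, mul_zero]
    rw [Finset.sum_ite_eq, Finset.sum_ite_eq, if_pos (by simp [P]), if_pos (by simp [P])]
  simp_rw [h, Finset.sum_mul]
  rw [Finset.sum_comm]
  refine Finset.sum_eq_zero fun p _ => ?_
  simp_rw [mul_assoc]
  rw [← Finset.mul_sum, hC p, mul_zero]

open Classical in
/-- The parity of the number of segments of `C` below the left end of `e`. -/
noncomputable def parityBelow (e : E) (C : cycleSpace S.inc) : ZMod 2 :=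
  ∑ e', if S.Below e' e ∧ (S.left e').1 ≤ (S.left e).1 then C.1 e' else 0

-- Pair `C` with the coboundary of the indicator of the region below `e`. A segment below `e`
-- contributes exactly when one of its ends lies in that region, that is, when it is counted at
-- exactly one end of `e`. So the label of a side may be read off at either end.
open Classical in
theorem parityBelow_eq_right (e : E) (C : cycleSpace S.inc) : S.parityBelow e C =
    ∑ e', if S.Below e' e ∧ (S.right e).1 ≤ (S.right e').1 then C.1 e' else 0 := by
  have h := S.sum_ends_mul_eq_zero C.2 (fun p => if S.PointBelow e p then 1 else 0)
  have h₂ : ∀ a b : ZMod 2, a + b = 0 → a = b := fun a b h => by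
    rwa [← CharTwo.sub_eq_add, sub_eq_zero] at h
  apply h₂
  refine Eq.trans ?_ h
  rw [parityBelow, ← Finset.sum_add_distrib]
  refine Finset.sum_congr rfl fun e' _ => ?_
  simp only [S.pointBelow_left_iff, S.pointBelow_right_iff]
  by_cases hb : S.Below e' e
  · by_cases k₁ : (S.left e).1 < (S.left e').1 <;>
      by_cases k₂ : (S.right e').1 < (S.right e).1 <;>
      simp [hb, k₁, k₂, not_le.2, not_lt.1, CharTwo.add_self_eq_zero]
  · simp [hb]

open Classical in
/-- The parity of the number of segments of `C` passing strictly below `p`. -/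
noncomputable def parityAt (p : ℝ × ℝ) (C : cycleSpace S.inc) : ZMod 2 :=
  ∑ e', if S.PassesBelow p e' then C.1 e' else 0

open Classical in
theorem parityBelow_eq_parityAt_left (e : E) : S.parityBelow e = S.parityAt (S.left e) +
    ∑ e' ∈ (Finset.univ.filter fun e' => S.left e' = S.left e) with S.slope e' < S.slope e,
      (fun C : cycleSpace S.inc => C.1 e') := by
  funext C
  rw [Pi.add_apply, Finset.sum_apply, Finset.filter_filter, Finset.sum_filter, parityBelow,
    parityAt, ← Finset.sum_add_distrib]
  refine Finset.sum_congr rfl fun e' _ => ?_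
  rw [if_congr (S.below_and_left_le_iff e e') rfl rfl]
  by_cases h : S.PassesBelow (S.left e) e'
  · have : S.left e' ≠ S.left e := fun hh => by have := h.1; rw [hh] at this; exact lt_irrefl _ this
    simp [h, this]
  · simp [h]

-- To the left of a common right end, larger slope means lower position; hence the sign.
open Classical in
theorem parityBelow_eq_parityAt_right (e : E) : S.parityBelow e = S.parityAt (S.right e) +
    ∑ e' ∈ (Finset.univ.filter fun e' => S.right e' = S.right e) with -S.slope e' < -S.slope e,
      (fun C : cycleSpace S.inc => C.1 e') := by
  funext C
  rw [Pi.add_apply, Finset.sum_apply, Finset.filter_filter, Finset.sum_filter,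
    parityBelow_eq_right, parityAt, ← Finset.sum_add_distrib]
  refine Finset.sum_congr rfl fun e' _ => ?_
  rw [if_congr (S.below_and_le_right_iff e e') rfl rfl]
  by_cases h : S.PassesBelow (S.right e) e'
  · have : S.right e' ≠ S.right e := fun hh => by
      have := h.2.1; rw [hh] at this; exact lt_irrefl _ this
    simp [h, this]
  · simp [h]

open Classical in
/-- The boundary of the face that is described by the values `F` of all parities: the segments with
exactly one side on that face. -/
noncomputable def faceBoundary (F : cycleSpace S.inc → ZMod 2) (e : E) : ZMod 2 :=
  (if S.parityBelow e = F then 1 else 0) +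
    (if (S.parityBelow e + fun C => C.1 e) = F then 1 else 0)

/-- The fans to the left and to the right of `p` have the same lowest label `S.parityAt p`. They
have the same highest label because each `C` meets both fans in the same parity. By telescoping, the
two fans contribute equally to the degree at `p`. -/
theorem faceBoundary_mem (F : cycleSpace S.inc → ZMod 2) :
    S.faceBoundary F ∈ cycleSpace S.inc := by
  classical
  intro p
  let g : (cycleSpace S.inc → ZMod 2) → ZMod 2 := fun m => if m = F then 1 else 0
  let χ : E → cycleSpace S.inc → ZMod 2 := fun e C => C.1 e
  have hl : ∑ e with S.left e = p, S.faceBoundary F e =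
      g (S.parityAt p) + g (S.parityAt p + ∑ e with S.left e = p, χ e) := by
    rw [← sum_telescope_of_injOn _ S.slope
      (fun e he e' he' h => S.eq_of_left_eq_of_slope_eq (by simp_all) h) χ (S.parityAt p) g]
    refine Finset.sum_congr rfl fun e he => ?_
    obtain rfl : S.left e = p := by simpa using he
    rw [faceBoundary, parityBelow_eq_parityAt_left, add_assoc]
  have hr : ∑ e with S.right e = p, S.faceBoundary F e =
      g (S.parityAt p) + g (S.parityAt p + ∑ e with S.right e = p, χ e) := by
    rw [← sum_telescope_of_injOn _ (fun e => -S.slope e)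
      (fun e he e' he' h => S.eq_of_right_eq_of_slope_eq (by simp_all) (neg_injective h)) χ
      (S.parityAt p) g]
    refine Finset.sum_congr rfl fun e he => ?_
    obtain rfl : S.right e = p := by simpa using he
    rw [faceBoundary, parityBelow_eq_parityAt_right, add_assoc]
  have hχ : ∑ e with S.left e = p, χ e = ∑ e with S.right e = p, χ e := by
    funext C
    have := C.2 p
    simp only [inc, add_mul, Finset.sum_add_distrib, ite_mul, one_mul, zero_mul] at this
    rw [← Finset.sum_filter, ← Finset.sum_filter, ← CharTwo.sub_eq_add, sub_eq_zero] at this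
    simpa [χ] using this
  simp only [inc, add_mul, Finset.sum_add_distrib, ite_mul, one_mul, zero_mul]
  rw [← Finset.sum_filter, ← Finset.sum_filter, hl, hr, hχ, CharTwo.add_self_eq_zero]

theorem hasTwofoldSpan : HasTwofoldSpan (cycleSpace S.inc) := by
  classical
  have := Fintype.ofFinite (cycleSpace S.inc)
  refine .of_fintype S.faceBoundary S.faceBoundary_mem (fun e => ?_) fun C hC => ?_
  · refine (Finset.card_le_card (t := {S.parityBelow e, S.parityBelow e + fun C => C.1 e})
      fun F hF => ?_).trans Finset.card_le_two
    by_contra h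
    simp only [Finset.mem_insert, Finset.mem_singleton, not_or] at h
    refine (Finset.mem_filter.1 hF).2 ?_
    rw [faceBoundary, if_neg (Ne.symm h.1), if_neg (Ne.symm h.2), add_zero]
  -- At `e`, the sum picks out the values at `C` of the two side labels of `e`, and these differ by
  -- `C e`.
  · have : C = ∑ F : cycleSpace S.inc → ZMod 2, F ⟨C, hC⟩ • S.faceBoundary F := by
      funext e
      simp only [faceBoundary, Finset.sum_apply, Pi.smul_apply, smul_eq_mul, mul_add,
        Finset.sum_add_distrib, mul_ite, mul_one, mul_zero]
      rw [Finset.sum_ite_eq, Finset.sum_ite_eq, if_pos (Finset.mem_univ _),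
        if_pos (Finset.mem_univ _), Pi.add_apply, ← add_assoc, CharTwo.add_self_eq_zero, zero_add]
    rw [this]
    exact Submodule.sum_mem _ fun F _ => Submodule.smul_mem _ _
      (Submodule.subset_span (Set.mem_range_self F))

end SegmentSystem

/-! ### From drawings to systems of segments -/

/-- The shear of the plane along the first axis. -/
def shear (t : ℝ) : (ℝ × ℝ) ≃ₗ[ℝ] (ℝ × ℝ) where
  toFun z := (z.1 + t * z.2, z.2)
  invFun z := (z.1 - t * z.2, z.2)
  map_add' x y := by ext <;> simp; ring
  map_smul' c x := by ext <;> simp; ring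
  left_inv x := by simp
  right_inv x := by simp

/-- Each pair of points with different second coordinates excludes only one `t`. -/
theorem exists_shear_injOn {P : Set (ℝ × ℝ)} (hP : P.Finite) :
    ∃ t : ℝ, ∀ a ∈ P, ∀ b ∈ P, (shear t a).1 = (shear t b).1 → a = b := by
  have hfin : (Set.image (fun q : (ℝ × ℝ) × (ℝ × ℝ) => (q.2.1 - q.1.1) / (q.1.2 - q.2.2))
      (P ×ˢ P)).Finite :=
    (hP.prod hP).image _
  obtain ⟨t, ht⟩ := hfin.infinite_compl.nonempty
  refine ⟨t, fun a ha b hb h => ?_⟩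
  simp only [shear, LinearEquiv.coe_mk, LinearMap.coe_mk, AddHom.coe_mk] at h
  by_cases h2 : a.2 = b.2
  · rw [h2] at h
    exact Prod.ext (by linarith) h2
  · refine absurd ⟨(a, b), ⟨ha, hb⟩, ?_⟩ ht
    have : a.2 - b.2 ≠ 0 := sub_ne_zero.2 h2
    simp only
    field_simp
    linarith

open Classical in
theorem hasTwofoldSpan_of_segments {E : Type*} [Fintype E] (a b : E → ℝ × ℝ)
    (hne : ∀ e, a e ≠ b e)
    (hmeet : ∀ e e', e ≠ e' → ∀ z, z ∈ segment ℝ (a e) (b e) → z ∈ segment ℝ (a e') (b e') →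
      z = a e ∨ z = b e) :
    HasTwofoldSpan (cycleSpace fun (p : ℝ × ℝ) (e : E) =>
      ((if a e = p then 1 else 0) + (if b e = p then 1 else 0) : ZMod 2)) := by
  obtain ⟨t, ht⟩ := exists_shear_injOn ((Set.finite_range a).union (Set.finite_range b))
  have hx : ∀ e, (shear t (a e)).1 ≠ (shear t (b e)).1 := fun e h =>
    hne e (ht _ (by simp) _ (by simp) h)
  let l : E → ℝ × ℝ := fun e => if (shear t (a e)).1 < (shear t (b e)).1 then a e else b e
  let r : E → ℝ × ℝ := fun e => if (shear t (a e)).1 < (shear t (b e)).1 then b e else a e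
  have hlr : ∀ e, (l e = a e ∧ r e = b e) ∨ (l e = b e ∧ r e = a e) := by
    intro e
    by_cases h : (shear t (a e)).1 < (shear t (b e)).1
    · left; simp [l, r, h]
    · right; simp [l, r, h]
  have hseg : ∀ e, segment ℝ (shear t (l e)) (shear t (r e)) =
      Set.image (shear t) (segment ℝ (a e) (b e)) := by
    intro e
    rcases hlr e with ⟨h, h'⟩ | ⟨h, h'⟩
    · rw [h, h']; exact (image_segment ℝ (shear t).toLinearMap.toAffineMap _ _).symm
    · rw [h, h', segment_symm]; exact (image_segment ℝ (shear t).toLinearMap.toAffineMap _ _).symm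
  have hmem : ∀ e p, (p = shear t (l e) ∨ p = shear t (r e)) →
      ∃ q, p = shear t q ∧ q ∈ Set.range a ∪ Set.range b := by
    rintro e p (rfl | rfl) <;> refine ⟨_, rfl, ?_⟩ <;>
      rcases hlr e with ⟨h, h'⟩ | ⟨h, h'⟩ <;> simp [h, h']
  let S : SegmentSystem E :=
    { left := fun e => shear t (l e)
      right := fun e => shear t (r e)
      left_lt_right := by
        intro e
        by_cases h : (shear t (a e)).1 < (shear t (b e)).1
        · simp [l, r, h]
        · simpa [l, r, h] using lt_of_le_of_ne (not_lt.1 h) (hx e).symm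
      eq_of_fst_eq := by
        intro e e' p p' hp hp' h
        obtain ⟨q, rfl, hq⟩ := hmem e p hp
        obtain ⟨q', rfl, hq'⟩ := hmem e' p' hp'
        rw [ht q hq q' hq' h]
      end_of_mem := by
        intro e e' he z hz hz'
        rw [hseg] at hz hz'
        obtain ⟨y, hy, rfl⟩ := hz
        obtain ⟨y', hy', h⟩ := hz'
        obtain rfl := (shear t).injective h
        simp only [EmbeddingLike.apply_eq_iff_eq]
        rcases hmeet e e' he _ hy hy' with h | h <;> rcases hlr e with ⟨k, k'⟩ | ⟨k, k'⟩ <;>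
          simp [h, k, k'] }
  have hinc : ∀ p e, S.inc (shear t p) e =
      ((if a e = p then 1 else 0) + (if b e = p then 1 else 0) : ZMod 2) := by
    intro p e
    simp only [SegmentSystem.inc, S, EmbeddingLike.apply_eq_iff_eq]
    rcases hlr e with ⟨k, k'⟩ | ⟨k, k'⟩
    · rw [k, k']
    · rw [k, k', add_comm]
  have hZ : cycleSpace S.inc = cycleSpace fun (p : ℝ × ℝ) (e : E) =>
      ((if a e = p then 1 else 0) + (if b e = p then 1 else 0) : ZMod 2) := by
    ext C
    simp only [mem_cycleSpace, ← hinc]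
    exact ⟨fun h p => h _, fun h p => by
      obtain ⟨q, rfl⟩ := (shear t).surjective p
      exact h q⟩
  rw [← hZ]
  exact S.hasTwofoldSpan

/-! ### Polygonal chains -/

section Chain

variable {n : ℕ} {p : ℕ → ℝ × ℝ}

theorem eq_of_mem_segment_of_chain
    (hcons : ∀ i, i + 1 < n →
      segment ℝ (p i) (p (i + 1)) ∩ segment ℝ (p (i + 1)) (p (i + 2)) = {p (i + 1)})
    (hdisj : ∀ i j, i + 1 < j → j < n →
      Disjoint (segment ℝ (p i) (p (i + 1))) (segment ℝ (p j) (p (j + 1))))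
    {i j : ℕ} (hi : i < n) (hj : j < n) (hij : i ≠ j) {z : ℝ × ℝ}
    (hz : z ∈ segment ℝ (p i) (p (i + 1))) (hz' : z ∈ segment ℝ (p j) (p (j + 1))) :
    z = p i ∨ z = p (i + 1) := by
  rcases lt_trichotomy i j with h | h | h
  · rcases (Nat.succ_le_of_lt h).lt_or_eq with h' | rfl
    · exact absurd hz' (Set.disjoint_left.1 (hdisj i j h' hj) hz)
    · right
      have := hcons i hj
      exact (Set.ext_iff.1 this z).1 ⟨hz, hz'⟩
  · exact absurd h hij
  · rcases (Nat.succ_le_of_lt h).lt_or_eq with h' | rfl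
    · exact absurd hz (Set.disjoint_left.1 (hdisj j i h' hi) hz')
    · left
      have := hcons j hi
      exact (Set.ext_iff.1 this z).1 ⟨hz', hz⟩

theorem index_of_mem_segment_of_chain (hinj : Set.InjOn p (Set.Iic n))
    (hcons : ∀ i, i + 1 < n →
      segment ℝ (p i) (p (i + 1)) ∩ segment ℝ (p (i + 1)) (p (i + 2)) = {p (i + 1)})
    (hdisj : ∀ i j, i + 1 < j → j < n →
      Disjoint (segment ℝ (p i) (p (i + 1))) (segment ℝ (p j) (p (j + 1))))
    {i k : ℕ} (hi : i < n) (hk : k ≤ n) (h : p k ∈ segment ℝ (p i) (p (i + 1))) :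
    k = i ∨ k = i + 1 := by
  obtain ⟨j, hj, hkj, hm⟩ : ∃ j < n, (k = j ∨ k = j + 1) ∧ p k ∈ segment ℝ (p j) (p (j + 1)) := by
    rcases hk.lt_or_eq with hk' | rfl
    · exact ⟨k, hk', Or.inl rfl, left_mem_segment ℝ _ _⟩
    · obtain ⟨m, rfl⟩ := Nat.exists_eq_succ_of_ne_zero (Nat.ne_zero_of_lt hi)
      exact ⟨m, Nat.lt_succ_self m, Or.inr rfl, right_mem_segment ℝ _ _⟩
  by_cases hij : i = j
  · rw [hij]; exact hkj
  · exact (eq_of_mem_segment_of_chain hcons hdisj hi hj hij h hm).imp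
      (hinj hk hi.le) (hinj hk (Nat.succ_le_of_lt hi))

end Chain

open Classical in
theorem sum_ends_chain (n : ℕ) (p : ℕ → ℝ × ℝ) (z : ℝ × ℝ) (c : ZMod 2) :
    ∑ i : Fin n, ((if p i = z then 1 else 0) + (if p (i + 1) = z then 1 else 0) : ZMod 2) * c =
      ((if p 0 = z then 1 else 0) + (if p n = z then 1 else 0) : ZMod 2) * c := by
  rw [← Finset.sum_mul, Fin.sum_univ_eq_sum_range
    (fun i => ((if p i = z then 1 else 0) + (if p (i + 1) = z then 1 else 0) : ZMod 2))]
  congr 1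
  induction n with
  | zero => simp [CharTwo.add_self_eq_zero]
  | succ n ih =>
    rw [Finset.sum_range_succ, ih]
    generalize (if p n = z then 1 else 0 : ZMod 2) = t
    rw [add_assoc, ← add_assoc t t, CharTwo.add_self_eq_zero, zero_add]

namespace SimpleGraph

open Classical in
/-- The incidence matrix of vertices and edges of a graph over `ZMod 2`. -/
noncomputable def edgeInc {V : Type*} (G : SimpleGraph V) (v : V) (e : G.edgeSet) : ZMod 2 :=
  if v ∈ (e : Sym2 V) then 1 else 0

/-- The segments of all arcs form a subdivision of `G`. Inner corners have degree two, so cycles of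
the subdivision are constant along arcs and correspond to cycles of `G`. -/
theorem PlaneDrawing.hasTwofoldSpan {V : Type*} {G : SimpleGraph V} [Fintype G.edgeSet]
    (D : G.PlaneDrawing) : HasTwofoldSpan (cycleSpace G.edgeInc) := by
  classical
  have hex : ∀ e : G.edgeSet, ∃ (u v : V) (n : ℕ) (p : ℕ → ℝ × ℝ), (e : Sym2 V) = s(u, v) ∧
      u ≠ v ∧ 0 < n ∧ p 0 = D.point u ∧ p n = D.point v ∧
      Set.InjOn p (Set.Iic n) ∧
      (∀ i, i + 1 < n →
        segment ℝ (p i) (p (i + 1)) ∩ segment ℝ (p (i + 1)) (p (i + 2)) = {p (i + 1)}) ∧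
      (∀ i j, i + 1 < j → j < n →
        Disjoint (segment ℝ (p i) (p (i + 1))) (segment ℝ (p j) (p (j + 1)))) ∧
      D.arc e = ⋃ i ∈ Set.Iio n, segment ℝ (p i) (p (i + 1)) := by
    rintro ⟨e, he⟩
    induction e with | _ u v =>
    obtain ⟨n, p, h⟩ := D.isPolygonalArc u v he
    exact ⟨u, v, n, p, rfl, G.ne_of_adj he, h⟩
  choose u v n p huv hne hn hp0 hpn hinj hcons hdisj harc using hex
  have hmem : ∀ e i, i < n e → segment ℝ (p e i) (p e (i + 1)) ⊆ D.arc e := by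
    intro e i hi z hz
    rw [harc]
    exact Set.mem_biUnion (show i ∈ Set.Iio (n e) from hi) hz
  have hend : ∀ e e', e ≠ e' → ∀ z, z ∈ D.arc e → z ∈ D.arc e' → z = p e 0 ∨ z = p e (n e) := by
    intro e e' he z hz hz'
    obtain ⟨w, hw, -, rfl⟩ := D.inter_subset e e' he z ⟨hz, hz'⟩
    rw [huv, Sym2.mem_iff] at hw
    rw [hp0, hpn]
    exact hw.imp (congrArg _) (congrArg _)
  let E' := Σ e : G.edgeSet, Fin (n e)
  have hS := hasTwofoldSpan_of_segments (E := E') (fun x => p x.1 x.2) (fun x => p x.1 (x.2 + 1))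
    (fun x h => by
      have := hinj x.1 (Set.mem_Iic.2 x.2.2.le) (Set.mem_Iic.2 x.2.2) h
      omega)
    (by
      rintro ⟨e, i⟩ ⟨e', j⟩ hij z hz hz'
      by_cases he : e = e'
      · subst he
        exact eq_of_mem_segment_of_chain (hcons e) (hdisj e) i.2 j.2
          (fun h => hij (by rw [Fin.ext h])) hz hz'
      · rcases hend e e' he z (hmem e i i.2 hz) (hmem e' j j.2 hz') with rfl | rfl
        · exact (index_of_mem_segment_of_chain (hinj e) (hcons e) (hdisj e) i.2 (Nat.zero_le _)
            hz).imp (congrArg _) (congrArg _)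
        · exact (index_of_mem_segment_of_chain (hinj e) (hcons e) (hdisj e) i.2 le_rfl
            hz).imp (congrArg _) (congrArg _))
  -- elements of the cycle space of the segments are constant along each arc
  have hconst : ∀ C ∈ cycleSpace (fun (z : ℝ × ℝ) (x : E') =>
      ((if p x.1 x.2 = z then 1 else 0) + (if p x.1 (x.2 + 1) = z then 1 else 0) : ZMod 2)),
      ∀ e (i : Fin (n e)), C ⟨e, i⟩ = C ⟨e, ⟨0, hn e⟩⟩ := by
    rintro C hC e ⟨i, hi⟩
    induction i with
    | zero => rfl
    | succ i ih =>
      have hi' : i < n e := by omega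
      rw [← ih hi']
      have h := hC (p e (i + 1))
      have hz : ∀ x : E', x ≠ ⟨e, ⟨i, hi'⟩⟩ → x ≠ ⟨e, ⟨i + 1, hi⟩⟩ →
          ((if p x.1 x.2 = p e (i + 1) then 1 else 0) +
            (if p x.1 (x.2 + 1) = p e (i + 1) then 1 else 0) : ZMod 2) * C x = 0 := by
        rintro ⟨e', j, hj⟩ h₁ h₂
        have key : p e (i + 1) ∉ segment ℝ (p e' j) (p e' (j + 1)) := by
          intro hm
          by_cases he : e = e'
          · subst he
            rcases index_of_mem_segment_of_chain (hinj e) (hcons e) (hdisj e) hj hi.le hm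
              with h | h
            · exact h₂ (by subst h; rfl)
            · exact h₁ (by obtain rfl : i = j := by omega
                           rfl)
          · rcases hend e e' he _ (hmem e i hi' (right_mem_segment ℝ _ _)) (hmem e' j hj hm)
              with h | h
            · have := hinj e (Set.mem_Iic.2 hi.le) (Set.mem_Iic.2 (Nat.zero_le _)) h
              omega
            · have := hinj e (Set.mem_Iic.2 hi.le) (Set.mem_Iic.2 le_rfl) h
              omega
        have k₁ : p e' j ≠ p e (i + 1) := fun h => key (h ▸ left_mem_segment ℝ _ _)
        have k₂ : p e' (j + 1) ≠ p e (i + 1) := fun h => key (h ▸ right_mem_segment ℝ _ _)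
        simp [k₁, k₂]
      have hxy : (⟨e, ⟨i, hi'⟩⟩ : E') ≠ ⟨e, ⟨i + 1, hi⟩⟩ := by
        intro h
        simp at h
      rw [Finset.sum_eq_add _ _ hxy (fun x _ hx => hz x hx.1 hx.2) (by simp) (by simp)] at h
      have k₁ : p e i ≠ p e (i + 1) := fun h => by
        have := hinj e (Set.mem_Iic.2 hi'.le) (Set.mem_Iic.2 hi.le) h
        omega
      have k₂ : p e (i + 1 + 1) ≠ p e (i + 1) := fun h => by
        have := hinj e (Set.mem_Iic.2 hi) (Set.mem_Iic.2 hi.le) h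
        omega
      simp only [k₁, k₂, if_true, if_false, zero_add, add_zero, one_mul] at h
      rw [← CharTwo.sub_eq_add, sub_eq_zero] at h
      exact h.symm
  have hsum : ∀ (C : G.edgeSet → ZMod 2) (z : ℝ × ℝ),
      ∑ x : E', ((if p x.1 x.2 = z then 1 else 0) +
        (if p x.1 (x.2 + 1) = z then 1 else 0) : ZMod 2) * C x.1 =
      ∑ e, ((if D.point (u e) = z then 1 else 0) +
        (if D.point (v e) = z then 1 else 0) : ZMod 2) * C e := by
    intro C z
    rw [Fintype.sum_sigma]
    refine Finset.sum_congr rfl fun e _ => ?_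
    simp only
    rw [sum_ends_chain, hp0, hpn]
  have hinc : ∀ w e, G.edgeInc w e = ((if D.point (u e) = D.point w then 1 else 0) +
        (if D.point (v e) = D.point w then 1 else 0) : ZMod 2) := by
    intro w e
    have hne := hne e
    simp only [edgeInc, huv, Sym2.mem_iff, D.point_injective.eq_iff]
    by_cases h₁ : u e = w
    · subst h₁
      simp [hne.symm]
    · by_cases h₂ : v e = w
      · simp [h₁, h₂]
      · simp [h₁, h₂, Ne.symm h₁, Ne.symm h₂]
  -- Reading a cycle off the first segment of each arc keeps the twofold bound.
  let ρ : (E' → ZMod 2) →ₗ[ZMod 2] (G.edgeSet → ZMod 2) :=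
    LinearMap.funLeft (ZMod 2) (ZMod 2) fun e => ⟨e, ⟨0, hn e⟩⟩
  obtain ⟨N, b, hb, hb2, hspan⟩ := hS
  refine ⟨N, fun i => ρ (b i), fun i w => ?_, fun e => hb2 _, fun C hC => ?_⟩
  · simp only [hinc]
    refine (hsum (ρ (b i)) (D.point w)).symm.trans (Eq.trans ?_ (hb i (D.point w)))
    refine Finset.sum_congr rfl fun x _ => ?_
    rw [show b i x = ρ (b i) x.1 from hconst _ (hb i) x.1 x.2]
  · have hlift : (fun x : E' => C x.1) ∈ Submodule.span (ZMod 2) (Set.range b) := by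
      apply hspan
      intro z
      simp only
      rw [hsum]
      by_cases hz : ∃ w, D.point w = z
      · obtain ⟨w, rfl⟩ := hz
        have := hC w
        simp only [hinc] at this
        exact this
      · push Not at hz
        simp [hz]
    have := Submodule.mem_map_of_mem (f := ρ) hlift
    rw [Submodule.map_span, ← Set.range_comp] at this
    exact this

end SimpleGraph

/-! ### Euler's inequality -/

/-- Double counting over a basis `c` and its sum, which is nonzero because the basis is independent
and, by `hr`, nonempty. If `t ≤ 2` basis elements contain `e`, the sum contains `e` only for odd
`t`, so the total cover of `e` is still at most 2. -/
theorem HasTwofoldSpan.finrank_add_one_mul_le {E : Type*} [Fintype E]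
    {Z : Submodule (ZMod 2) (E → ZMod 2)} (h : HasTwofoldSpan Z) {g : ℕ}
    (hg : ∀ C ∈ Z, C ≠ 0 → g ≤ (Finset.univ.filter fun e => C e ≠ 0).card)
    (hr : 0 < Module.finrank (ZMod 2) Z) :
    (Module.finrank (ZMod 2) Z + 1) * g ≤ 2 * Fintype.card E := by
  classical
  obtain ⟨n, b, hb, hb2, hspan⟩ := h
  obtain ⟨κ, a, ha, hsp, hli⟩ := exists_linearIndependent' (ZMod 2) b
  have : Fintype κ := Fintype.ofInjective a ha
  have hZ : Z = Submodule.span (ZMod 2) (Set.range (b ∘ a)) := by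
    rw [hsp]
    exact le_antisymm hspan (Submodule.span_le.2 (by rintro _ ⟨i, rfl⟩; exact hb i))
  have hcard : Module.finrank (ZMod 2) Z = Fintype.card κ := by
    rw [hZ]
    exact finrank_span_eq_card hli
  rw [hcard] at hr ⊢
  have hne : Nonempty κ := Fintype.card_pos_iff.1 hr
  set c := b ∘ a with hc
  have hcZ : ∀ k, c k ∈ Z := fun k => hb _
  have h0 : ∑ k, c k ≠ 0 := by
    intro h0
    have := linearIndependent_iff'.1 hli Finset.univ (fun _ => 1) (by simpa using h0)
      hne.some (Finset.mem_univ _)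
    exact one_ne_zero this
  have h0Z : ∑ k, c k ∈ Z := Submodule.sum_mem _ fun k _ => hcZ k
  have hpt : ∀ e, (Finset.univ.filter fun k => c k e ≠ 0).card +
      (if (∑ k, c k) e ≠ 0 then 1 else 0) ≤ 2 := by
    intro e
    have hle : (Finset.univ.filter fun k => c k e ≠ 0).card ≤ 2 := by
      refine (Finset.card_le_card_of_injOn a ?_ ha.injOn).trans (hb2 e)
      intro k hk
      simpa [hc] using hk
    have hsum : (∑ k, c k) e = ((Finset.univ.filter fun k => c k e ≠ 0).card : ZMod 2) := by
      rw [Finset.sum_apply, Finset.card_filter, Nat.cast_sum]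
      refine Finset.sum_congr rfl fun k _ => ?_
      generalize c k e = t
      revert t
      decide
    rw [hsum]
    generalize (Finset.univ.filter fun k => c k e ≠ 0).card = t at hle
    interval_cases t <;> decide
  calc (Fintype.card κ + 1) * g
      = ∑ _k : κ, g + g := by simp [add_mul]
    _ ≤ ∑ k : κ, (Finset.univ.filter fun e => c k e ≠ 0).card +
        (Finset.univ.filter fun e => (∑ k, c k) e ≠ 0).card :=
      add_le_add (Finset.sum_le_sum fun k _ => hg _ (hcZ k) (hli.ne_zero k)) (hg _ h0Z h0)
    _ = ∑ e, ((Finset.univ.filter fun k => c k e ≠ 0).card +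
        (if (∑ k, c k) e ≠ 0 then 1 else 0)) := by
      rw [Finset.sum_add_distrib, ← Finset.card_filter]
      simp_rw [Finset.card_filter]
      rw [Finset.sum_comm]
    _ ≤ ∑ _e : E, 2 := Finset.sum_le_sum fun e _ => hpt e
    _ = 2 * Fintype.card E := by simp [mul_comm]

/-- All columns lie in the hyperplane of vectors with coordinate sum 0, so the rank is less than the
number of rows. -/
theorem card_add_one_le_finrank_cycleSpace {E P : Type*} [Fintype E] [Fintype P] [Nonempty P]
    (inc : P → E → ZMod 2) (h : ∀ e, ∑ p, inc p e = 0) :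
    Fintype.card E + 1 ≤ Module.finrank (ZMod 2) (cycleSpace inc) + Fintype.card P := by
  classical
  let f : (E → ZMod 2) →ₗ[ZMod 2] (P → ZMod 2) := (Matrix.of inc).mulVecLin
  have hf : ∀ C p, f C p = ∑ e, inc p e * C e := fun C p => rfl
  have hker : f.ker = cycleSpace inc := by
    ext C
    rw [LinearMap.mem_ker, mem_cycleSpace, funext_iff]
    simp [hf]
  have hlt : Module.finrank (ZMod 2) f.range < Fintype.card P := by
    rw [← Module.finrank_fintype_fun_eq_card (ZMod 2) (η := P)]
    apply Submodule.finrank_lt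
    intro htop
    obtain ⟨p⟩ := ‹Nonempty P›
    obtain ⟨C, hC⟩ : Pi.single p 1 ∈ f.range := htop ▸ Submodule.mem_top
    have h₁ : ∑ q, f C q = 1 := by rw [hC]; simp
    have h₂ : ∑ q, f C q = 0 := by
      simp_rw [hf]
      rw [Finset.sum_comm]
      refine Finset.sum_eq_zero fun e _ => ?_
      rw [← Finset.sum_mul, h e, zero_mul]
    exact one_ne_zero (h₁.symm.trans h₂)
  have := f.finrank_range_add_finrank_ker
  rw [hker, Module.finrank_fintype_fun_eq_card] at this
  omega

namespace SimpleGraph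

open Classical in
theorem sum_edgeInc {V : Type*} {G : SimpleGraph V} (K : Finset V) {x y : V} (h : G.Adj x y) :
    ∑ v ∈ K, G.edgeInc v ⟨s(x, y), h⟩ = (if x ∈ K then 1 else 0) + (if y ∈ K then 1 else 0) := by
  have : ∀ v, G.edgeInc v ⟨s(x, y), h⟩ = (if v = x then 1 else 0) + (if v = y then 1 else 0) := by
    intro v
    have hne := h.ne
    simp only [edgeInc, Sym2.mem_iff]
    by_cases h₁ : v = x
    · subst h₁; simp [hne]
    · simp [h₁]
  simp_rw [this, Finset.sum_add_distrib, Finset.sum_ite_eq']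

/-- The support `H` of `C` contains a graph cycle. Otherwise an edge `ab` of `H` is a bridge; adding
the cycle conditions over the side `K` of `a`, every other edge of the support counts 0 or 2 times,
which leaves `C(ab) = 0`. -/
theorem egirth_le_card_of_mem_cycleSpace {V : Type*} [Fintype V] {G : SimpleGraph V}
    [Fintype G.edgeSet] {C : G.edgeSet → ZMod 2} (hC : C ∈ cycleSpace G.edgeInc) (h0 : C ≠ 0) :
    G.egirth ≤ ((Finset.univ.filter fun e => C e ≠ 0).card : ℕ∞) := by
  classical
  let H : SimpleGraph V :=
    { Adj := fun x y => ∃ h : G.Adj x y, C ⟨s(x, y), h⟩ ≠ 0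
      symm := ⟨fun x y ⟨h, hc⟩ => ⟨h.symm, by
        have : (⟨s(y, x), h.symm⟩ : G.edgeSet) = ⟨s(x, y), h⟩ := Subtype.ext Sym2.eq_swap
        rwa [this]⟩⟩
      loopless := ⟨fun x ⟨h, _⟩ => G.irrefl h⟩ }
  have hHG : H ≤ G := fun x y h => h.1
  have hcyc : ¬ H.IsAcyclic := by
    intro hac
    obtain ⟨⟨e₀, he₀⟩, hne⟩ := Function.ne_iff.1 h0
    induction e₀ with | _ a b =>
    have hbr := isBridge_iff.1 (isAcyclic_iff_forall_adj_isBridge.1 hac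
      (show H.Adj a b from ⟨he₀, hne⟩))
    set H' := H.deleteEdges {s(a, b)} with hH'
    let K : Finset V := Finset.univ.filter fun v => H'.Reachable a v
    have h1 : ∑ e, (∑ v ∈ K, G.edgeInc v e) * C e = 0 := by
      simp_rw [Finset.sum_mul]
      rw [Finset.sum_comm]
      exact Finset.sum_eq_zero fun v _ => hC v
    rw [Finset.sum_eq_single (⟨s(a, b), he₀⟩ : G.edgeSet)] at h1
    · rw [sum_edgeInc (G := G) K he₀, if_pos (by simp [K]), if_neg (by simpa [K] using hbr), add_zero,
        one_mul] at h1
      exact hne h1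
    · rintro ⟨e, he⟩ - hee
      induction e with | _ x y =>
      by_cases hc : C ⟨s(x, y), he⟩ = 0
      · rw [hc, mul_zero]
      · have hadj : H'.Adj x y := by
          rw [hH', deleteEdges_adj]
          exact ⟨⟨he, hc⟩, fun h => hee (Subtype.ext h)⟩
        have hiff : x ∈ K ↔ y ∈ K := by
          simp only [K, Finset.mem_filter, Finset.mem_univ, true_and]
          exact ⟨fun h => h.trans hadj.reachable, fun h => h.trans hadj.symm.reachable⟩
        rw [sum_edgeInc (G := G) K he, if_congr hiff rfl rfl, CharTwo.add_self_eq_zero, zero_mul]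
    · simp
  obtain ⟨a, w, hw, hlen⟩ := exists_egirth_eq_length.2 hcyc
  refine (egirth_anti hHG).trans ?_
  rw [hlen, Nat.cast_le, ← Walk.length_edges, ← List.toFinset_card_of_nodup hw.isTrail.edges_nodup,
    ← Finset.card_map (Function.Embedding.subtype (· ∈ G.edgeSet))]
  refine Finset.card_le_card fun e he => ?_
  have he' := w.edges_subset_edgeSet (List.mem_toFinset.1 he)
  induction e with | _ x y =>
  obtain ⟨h, hc⟩ : H.Adj x y := he'
  simp only [Finset.mem_map, Finset.mem_filter, Finset.mem_univ, true_and]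
  exact ⟨⟨s(x, y), h⟩, hc, rfl⟩

/-- Euler's inequality for planar graphs of girth at least `g` that have at least as many edges as
non-isolated vertices. -/
theorem IsPlanar.euler_le {V : Type*} [Fintype V] {G : SimpleGraph V} [Fintype G.edgeSet]
    (hG : G.IsPlanar) {g : ℕ} (hg : (g : ℕ∞) ≤ G.egirth) (s : Finset V) (hs : s.Nonempty)
    (hsup : ∀ e ∈ G.edgeSet, ∀ v ∈ e, v ∈ s) (hcard : s.card ≤ Fintype.card G.edgeSet) :
    (Fintype.card G.edgeSet + 2) * g ≤ 2 * Fintype.card G.edgeSet + s.card * g := by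
  classical
  obtain ⟨D⟩ := hG
  have : Nonempty s := hs.to_subtype
  have hZ : cycleSpace (fun (v : s) e => G.edgeInc v e) = cycleSpace G.edgeInc := by
    ext C
    simp only [mem_cycleSpace]
    refine ⟨fun h v => ?_, fun h v => h v⟩
    by_cases hv : v ∈ s
    · exact h ⟨v, hv⟩
    · refine Finset.sum_eq_zero fun e _ => ?_
      rw [edgeInc, if_neg fun hve => hv (hsup e e.2 v hve), zero_mul]
  have hrank := card_add_one_le_finrank_cycleSpace (fun (v : s) e => G.edgeInc v e) (by
    rintro ⟨e, he⟩
    induction e with | _ x y =>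
    have := sum_edgeInc s he
    rw [if_pos (hsup _ he x (by simp)), if_pos (hsup _ he y (by simp)),
      CharTwo.add_self_eq_zero] at this
    rw [← this]
    exact Finset.sum_coe_sort s (fun v => G.edgeInc v ⟨s(x, y), he⟩))
  rw [hZ, Fintype.card_coe] at hrank
  -- The assumption `hcard` makes the rank positive.
  have := D.hasTwofoldSpan.finrank_add_one_mul_le (g := g)
    (fun C hC h0 => by exact_mod_cast hg.trans (egirth_le_card_of_mem_cycleSpace hC h0)) (by omega)
  calc (Fintype.card G.edgeSet + 2) * g
      ≤ (Module.finrank (ZMod 2) (cycleSpace G.edgeInc) + 1 + s.card) * g :=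
        Nat.mul_le_mul_right _ (by omega)
    _ ≤ _ := by rw [add_mul]; omega

theorem IsPlanar.mono {V : Type*} {G H : SimpleGraph V} (hG : G.IsPlanar) (h : H ≤ G) :
    H.IsPlanar := by
  obtain ⟨D⟩ := hG
  have he : ∀ e : H.edgeSet, (e : Sym2 V) ∈ G.edgeSet := fun e => edgeSet_mono h e.2
  exact ⟨{
    point := D.point
    point_injective := D.point_injective
    arc := fun e => D.arc ⟨e, he e⟩
    isPolygonalArc := fun u v huv => D.isPolygonalArc u v (h huv)
    mem_of_point_mem := fun e v hv => D.mem_of_point_mem ⟨e, he e⟩ v hv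
    inter_subset := fun e e' hne q hq =>
      D.inter_subset ⟨e, he e⟩ ⟨e', he e'⟩ (fun hh => hne (Subtype.ext (congrArg
        (fun x : G.edgeSet => (x : Sym2 V)) hh))) q hq }⟩

end SimpleGraph

namespace SimpleGraph

/-! ### Light edges -/

/-- The extremal pair is `(2, k)`. After clearing denominators, the difference of the two sides is
`(k + 2)` times the product in `h₁` plus the product in `h₂`. -/
theorem inv_add_inv_le_of_add_two_le {a b k : ℕ} (hk : 0 < k) (ha : a ≤ k) (hb : b ≤ k)
    (hab : k + 2 ≤ a + b) : (1 / a + 1 / b : ℚ) ≤ (k + 2) / (2 * k) := by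
  have hk' : (0 : ℚ) < k := by exact_mod_cast hk
  have ha2 : (2 : ℚ) ≤ a := by exact_mod_cast (by omega : 2 ≤ a)
  have hb2 : (2 : ℚ) ≤ b := by exact_mod_cast (by omega : 2 ≤ b)
  have ha' : (a : ℚ) ≤ k := by exact_mod_cast ha
  have hb' : (b : ℚ) ≤ k := by exact_mod_cast hb
  have hab' : (k + 2 : ℚ) ≤ a + b := by exact_mod_cast hab
  rw [div_add_div _ _ (by positivity) (by positivity), div_le_div_iff₀ (by positivity)
    (by positivity)]
  have h₁ : 0 ≤ ((b : ℚ) - 2) * (k - b) := mul_nonneg (by linarith) (by linarith)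
  have h₂ : 0 ≤ ((k + 2) * b - 2 * k : ℚ) * (a + b - (k + 2)) :=
    mul_nonneg (by nlinarith) (by linarith)
  nlinarith

/-- Every non-isolated vertex splits weight 1 equally among its edges; an edge `xy` receives `1/deg
x + 1/deg y`. -/
theorem two_mul_card_support_le {V : Type*} [Fintype V] [DecidableEq V] (H : SimpleGraph V)
    [DecidableRel H.Adj] {k : ℕ} (hk : 0 < k) (hdeg : ∀ v, H.degree v ≤ k)
    (h : ∀ x y, H.Adj x y → k + 2 ≤ H.degree x + H.degree y) :
    2 * k * (Finset.univ.filter fun v => 0 < H.degree v).card ≤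
      (k + 2) * H.edgeFinset.card := by
  set s := Finset.univ.filter fun v => 0 < H.degree v with hs
  have key : (s.card : ℚ) ≤ H.edgeFinset.card * ((k + 2) / (2 * k)) := by
    calc (s.card : ℚ) = ∑ v ∈ s, ∑ e ∈ H.edgeFinset, if v ∈ e then (1 / H.degree v : ℚ) else 0 := by
          rw [Finset.card_eq_sum_ones, Nat.cast_sum]
          refine Finset.sum_congr rfl fun v hv => ?_
          have hv' : (H.degree v : ℚ) ≠ 0 := by
            have := (Finset.mem_filter.1 hv).2
            positivity
          rw [← Finset.sum_filter, ← incidenceFinset_eq_filter, Finset.sum_const,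
            card_incidenceFinset_eq_degree, nsmul_eq_mul]
          field_simp
          simp
      _ = ∑ e ∈ H.edgeFinset, ∑ v ∈ s, if v ∈ e then (1 / H.degree v : ℚ) else 0 :=
          Finset.sum_comm
      _ ≤ ∑ e ∈ H.edgeFinset, ((k + 2) / (2 * k) : ℚ) := by
          refine Finset.sum_le_sum fun e he => ?_
          induction e with | _ x y =>
          have hxy : H.Adj x y := by simpa using he
          refine le_trans (le_of_eq ?_)
            (inv_add_inv_le_of_add_two_le hk (hdeg x) (hdeg y) (h x y hxy))
          have hf : s.filter (fun v => v ∈ s(x, y)) = {x, y} := by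
            ext v
            simp only [hs, Finset.mem_filter, Finset.mem_univ, true_and, Sym2.mem_iff,
              Finset.mem_insert, Finset.mem_singleton, and_iff_right_iff_imp]
            rintro (rfl | rfl)
            · exact (H.degree_pos_iff_exists_adj _).2 ⟨_, hxy⟩
            · exact (H.degree_pos_iff_exists_adj _).2 ⟨_, hxy.symm⟩
          rw [← Finset.sum_filter, hf, Finset.sum_pair hxy.ne]
      _ = _ := by rw [Finset.sum_const, nsmul_eq_mul]
  have hk' : (0 : ℚ) < k := by exact_mod_cast hk
  rw [← mul_div_assoc, le_div_iff₀ (by positivity)] at key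
  have : (2 * k * s.card : ℚ) ≤ (k + 2) * H.edgeFinset.card := by linarith
  exact_mod_cast this

theorem IsPlanar.exists_adj_degree_add_degree_le {V : Type*} [Fintype V]
    {H : SimpleGraph V} [DecidableRel H.Adj] (hH : H.IsPlanar) {d g k : ℕ} (hd : 3 ≤ d)
    (hdk : d ≤ k) (hgd : 4 * d ≤ g * (d - 2)) (hg : (g : ℕ∞) ≤ H.egirth)
    (hdeg : ∀ v, H.degree v ≤ k) (hne : H ≠ ⊥) :
    ∃ x y, H.Adj x y ∧ H.degree x + H.degree y ≤ k + 1 := by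
  classical
  by_contra! hcon
  have hcount := H.two_mul_card_support_le (by omega : 0 < k) hdeg
    (fun x y hxy => hcon x y hxy)
  set s := Finset.univ.filter fun v => 0 < H.degree v with hs
  have hmem : ∀ e ∈ H.edgeSet, ∀ v ∈ e, v ∈ s := by
    intro e he v hv
    obtain ⟨y, rfl⟩ := Sym2.mem_iff_exists.1 hv
    simp only [hs, Finset.mem_filter, Finset.mem_univ, true_and]
    exact (H.degree_pos_iff_exists_adj _).2 ⟨y, he⟩
  have hsne : s.Nonempty := by
    obtain ⟨x, y, hxy⟩ := ne_bot_iff_exists_adj.1 hne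
    exact ⟨x, hmem s(x, y) hxy x (by simp)⟩
  have hle : s.card ≤ H.edgeFinset.card := by
    have h₁ : (k + 2) * H.edgeFinset.card ≤ 2 * k * H.edgeFinset.card :=
      Nat.mul_le_mul_right _ (by omega)
    exact Nat.le_of_mul_le_mul_left (hcount.trans h₁) (by omega)
  have hE := hH.euler_le hg s hsne hmem (by rwa [← edgeFinset_card])
  rw [← edgeFinset_card] at hE
  generalize H.edgeFinset.card = m at *
  generalize s.card = n at *
  obtain ⟨c, rfl⟩ := Nat.exists_eq_add_of_le hle
  obtain ⟨t, rfl⟩ := Nat.exists_eq_add_of_le hd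
  have e₁ : (c + 2) * g ≤ 2 * (n + c) := by nlinarith
  have e₂ : 4 * (3 + t) ≤ g * (1 + t) := by
    rwa [show 3 + t - 2 = 1 + t by omega] at hgd
  have e₃ : (c + 2) * (4 * (3 + t)) ≤ 2 * (n + c) * (1 + t) :=
    calc (c + 2) * (4 * (3 + t)) ≤ (c + 2) * (g * (1 + t)) := Nat.mul_le_mul_left _ e₂
      _ = (c + 2) * g * (1 + t) := by ring
      _ ≤ _ := Nat.mul_le_mul_right _ e₁
  obtain ⟨j, rfl⟩ := Nat.exists_eq_add_of_le hdk
  -- With `m = n + c`, `d = 3 + t` and `k = d + j`, half of `e₄` plus `e₅` gives `2dk(m + 2) ≤ 2dkm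
  -- - 2jm`, which is absurd.
  have e₄ := Nat.mul_le_mul_left (3 + t + j) e₃
  have e₅ := Nat.mul_le_mul_left (3 + t) hcount
  nlinarith [Nat.zero_le (j * (n + c)), Nat.zero_le (t * j), Nat.zero_le (t * t)]

open Classical in
theorem card_lineGraph_neighbors_lt {V : Type*} [Fintype V] {G : SimpleGraph V}
    [DecidableRel G.Adj] (hG : G.IsPlanar) {d g : ℕ} (hd : 3 ≤ d) (hdG : d ≤ G.maxDegree)
    (hgd : 4 * d ≤ g * (d - 2)) (hg : (g : ℕ∞) ≤ G.egirth) (S : Finset G.edgeSet)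
    (hS : S.Nonempty) :
    ∃ e ∈ S, (S.filter fun e' => G.lineGraph.Adj e e').card < G.maxDegree := by
  let H : SimpleGraph V := fromEdgeSet (Set.image Subtype.val (S : Set G.edgeSet))
  have hHadj : ∀ x y, H.Adj x y ↔ ∃ h : G.Adj x y, (⟨s(x, y), h⟩ : G.edgeSet) ∈ S := by
    intro x y
    simp only [H, fromEdgeSet_adj, Set.mem_image, Finset.mem_coe]
    constructor
    · rintro ⟨⟨⟨e, he⟩, heS, rfl⟩, -⟩
      exact ⟨he, heS⟩
    · rintro ⟨h, hS⟩
      exact ⟨⟨_, hS, rfl⟩, h.ne⟩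
  have hHG : H ≤ G := fun x y h => ((hHadj x y).1 h).1
  have hne : H ≠ ⊥ := by
    obtain ⟨⟨e, he⟩, heS⟩ := hS
    induction e with | _ x y =>
    exact ne_bot_iff_exists_adj.2 ⟨x, y, (hHadj x y).2 ⟨he, heS⟩⟩
  obtain ⟨x, y, hxy, hlt⟩ := (hG.mono hHG).exists_adj_degree_add_degree_le hd hdG hgd
    (hg.trans (egirth_anti hHG))
    (fun v => (degree_le_of_le hHG).trans (G.degree_le_maxDegree v)) hne
  obtain ⟨hadj, hmem⟩ := (hHadj x y).1 hxy
  refine ⟨_, hmem, ?_⟩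
  have hinc : ∀ v, v ∈ s(x, y) →
      ((H.incidenceFinset v).erase s(x, y)).card = H.degree v - 1 := by
    intro v hv
    rw [Finset.card_erase_of_mem, card_incidenceFinset_eq_degree]
    rw [mem_incidenceFinset]
    exact ⟨hxy, hv⟩
  have hsub : ((S.filter fun e' => G.lineGraph.Adj ⟨s(x, y), hadj⟩ e').map
      (Function.Embedding.subtype (· ∈ G.edgeSet))) ⊆
      (H.incidenceFinset x).erase s(x, y) ∪ (H.incidenceFinset y).erase s(x, y) := by
    intro e he
    obtain ⟨⟨e, heG⟩, he', rfl⟩ := Finset.mem_map.1 he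
    obtain ⟨heS, hadj'⟩ := Finset.mem_filter.1 he'
    obtain ⟨hne, v, hv, hve⟩ := lineGraph_adj_iff_exists.1 hadj'
    have hne' : e ≠ s(x, y) := fun h => hne (Subtype.ext h.symm)
    have heH : e ∈ H.edgeSet := by
      induction e with | _ a b =>
      exact (hHadj a b).2 ⟨heG, heS⟩
    simp only [Finset.mem_union, Finset.mem_erase, mem_incidenceFinset]
    rcases Sym2.mem_iff.1 hv with rfl | rfl
    · exact Or.inl ⟨hne', heH, hve⟩
    · exact Or.inr ⟨hne', heH, hve⟩
  -- The neighbors number at most `(deg x - 1) + (deg y - 1) ≤ Δ(G) - 1`.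
  have := (Finset.card_le_card hsub).trans (Finset.card_union_le _ _)
  rw [Finset.card_map, hinc x (by simp), hinc y (by simp)] at this
  have hx : 0 < H.degree x := (H.degree_pos_iff_exists_adj _).2 ⟨_, hxy⟩
  have hy : 0 < H.degree y := (H.degree_pos_iff_exists_adj _).2 ⟨_, hxy.symm⟩
  omega

/-! ### Group colorings -/

open Classical in
theorem isGroupChoosable_of_degenerate {W : Type u} [Finite W] (X : SimpleGraph W) (k : ℕ)
    (hdeg : ∀ S : Finset W, S.Nonempty → ∃ e ∈ S, (S.filter fun e' => X.Adj e e').card < k) :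
    IsGroupChoosable.{u, w} X k := by
  intro A _ _ L hL D f
  have := Fintype.ofFinite W
  suffices h : ∀ S : Finset W, ∃ c : W → A, (∀ u ∈ S, ∀ v ∈ S, ∀ h : D.Dir u v,
      c u - c v ≠ f ⟨s(u, v), D.adj_of_dir h⟩) ∧ ∀ v ∈ S, c v ∈ L v by
    obtain ⟨c, hc, hcL⟩ := h Finset.univ
    exact ⟨c, fun u v h => hc u (Finset.mem_univ _) v (Finset.mem_univ _) h,
      fun v => hcL v (Finset.mem_univ _)⟩
  intro S
  induction S using Finset.strongInduction with | _ S ih =>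
  rcases S.eq_empty_or_nonempty with rfl | hS
  · exact ⟨fun _ => 0, by simp, by simp⟩
  obtain ⟨e, heS, hlt⟩ := hdeg S hS
  obtain ⟨c, hc, hcL⟩ := ih (S.erase e) (Finset.erase_ssubset heS)
  -- The one color at `e` forbidden by `e'`; the default 0 is never reached at a neighbor.
  let φ : W → A := fun e' =>
    if h : D.Dir e e' then f ⟨s(e, e'), D.adj_of_dir h⟩ + c e'
    else if h : D.Dir e' e then c e' - f ⟨s(e', e), D.adj_of_dir h⟩ else 0
  obtain ⟨a, haL, haφ⟩ : ∃ a ∈ L e, a ∉ (S.filter fun e' => X.Adj e e').image φ :=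
    Finset.exists_mem_notMem_of_card_lt_card
      (Finset.card_image_le.trans_lt (by rwa [hL]))
  refine ⟨Function.update c e a, fun u hu v hv h => ?_, fun v hv => ?_⟩
  · have huv : u ≠ v := (D.adj_of_dir h).ne
    by_cases hue : u = e
    · subst hue
      rw [Function.update_self, Function.update_of_ne huv.symm]
      intro heq
      refine haφ (Finset.mem_image.2 ⟨v, Finset.mem_filter.2 ⟨hv, D.adj_of_dir h⟩, ?_⟩)
      simp only [φ, dif_pos h, ← heq, sub_add_cancel]
    · by_cases hve : v = e
      · subst hve
        rw [Function.update_self, Function.update_of_ne huv]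
        intro heq
        refine haφ (Finset.mem_image.2 ⟨u, Finset.mem_filter.2 ⟨hu, (D.adj_of_dir h).symm⟩, ?_⟩)
        simp only [φ, dif_pos h, dif_neg (D.asymm h), ← heq, sub_sub_cancel]
      · rw [Function.update_of_ne hue, Function.update_of_ne hve]
        exact hc u (Finset.mem_erase.2 ⟨hue, hu⟩) v (Finset.mem_erase.2 ⟨hve, hv⟩) h
  · by_cases hve : v = e
    · subst hve
      rwa [Function.update_self]
    · rw [Function.update_of_ne hve]
      exact hcL v (Finset.mem_erase.2 ⟨hve, hv⟩)

theorem IsGroupChoosable.isGroupColorable {W : Type u} {X : SimpleGraph W} {k : ℕ}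
    (h : IsGroupChoosable.{u, w} X k) (A : Type w) [AddCommGroup A] (hA : (k : ℕ∞) ≤ ENat.card A) :
    X.IsGroupColorable A := by
  intro D f
  rw [← Set.encard_univ] at hA
  obtain ⟨t, -, ht⟩ := Set.exists_subset_encard_eq hA
  have hfin : t.Finite := Set.finite_of_encard_eq_coe ht
  obtain ⟨c, hc, -⟩ := h A (by rwa [← Set.encard_univ]) (fun _ => hfin.toFinset)
    (fun _ => by rw [hfin.encard_eq_coe_toFinset_card] at ht; exact_mod_cast ht) D f
  exact ⟨c, hc⟩

/-! ### The lower bound from cliques -/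

theorem nonempty_edgeOrientation {W : Type u} (X : SimpleGraph W) : Nonempty X.EdgeOrientation :=
  ⟨{ Dir := fun u v => X.Adj u v ∧ WellOrderingRel u v
     adj_of_dir := fun h => h.1
     dir_or_dir := fun {u v} h => by
      rcases trichotomous_of WellOrderingRel u v with h' | h' | h'
      · exact Or.inl ⟨h, h'⟩
      · exact absurd h' h.ne
      · exact Or.inr ⟨h.symm, h'⟩
     asymm := fun h h' => asymm_of WellOrderingRel h.2 h'.2 }⟩

theorem IsGroupColorable.card_le {W : Type u} {X : SimpleGraph W} {A : Type w} [AddCommGroup A]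
    [Finite A] (h : X.IsGroupColorable A) {K : Finset W} (hK : X.IsClique K) :
    K.card ≤ Nat.card A := by
  classical
  have := Fintype.ofFinite A
  obtain ⟨D⟩ := X.nonempty_edgeOrientation
  obtain ⟨c, hc⟩ := h D 0
  have hinj : Set.InjOn c K := by
    intro u hu v hv huv
    by_contra hne
    rcases D.dir_or_dir (hK hu hv hne) with hd | hd
    · exact hc u v hd (by simp [huv])
    · exact hc v u hd (by simp [huv])
  rw [Nat.card_eq_fintype_card, ← Finset.card_image_of_injOn hinj]
  exact Finset.card_le_univ _

theorem exists_isClique_lineGraph {V : Type u} [Fintype V] [Nonempty V] (G : SimpleGraph V)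
    [DecidableRel G.Adj] : ∃ K : Finset G.edgeSet, G.lineGraph.IsClique K ∧ K.card = G.maxDegree := by
  classical
  obtain ⟨v, hv⟩ := G.exists_maximal_degree_vertex
  refine ⟨(G.incidenceFinset v).subtype (· ∈ G.edgeSet), ?_, ?_⟩
  · intro e he e' he' hne
    rw [Finset.mem_coe, Finset.mem_subtype, mem_incidenceFinset] at he he'
    exact lineGraph_adj_iff_exists.2 ⟨hne, v, he.2, he'.2⟩
  · rw [Finset.card_subtype, Finset.filter_true_of_mem, card_incidenceFinset_eq_degree, hv]
    intro e he
    exact ((mem_incidenceFinset _ _ _).1 he).1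

theorem maxDegree_le_of_forall_isGroupColorable {V : Type u} [Fintype V] (G : SimpleGraph V)
    [DecidableRel G.Adj] (hG : 2 ≤ G.maxDegree) (m : ℕ)
    (h : ∀ (A : Type w) [AddCommGroup A], (m : ℕ∞) ≤ ENat.card A → G.lineGraph.IsGroupColorable A) :
    G.maxDegree ≤ m := by
  have : Nonempty V := by
    by_contra hV
    rw [not_nonempty_iff] at hV
    simp at hG
  -- `ZMod 0` is infinite, so for `m = 0` the trivial group is used; it gives `Δ(G) ≤ 1`, contrary
  -- to `hG`.
  have : NeZero (max m 1) := ⟨by omega⟩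
  obtain ⟨K, hK, hcard⟩ := G.exists_isClique_lineGraph
  have hA : Nat.card (ULift.{w} (ZMod (max m 1))) = max m 1 := by
    rw [Nat.card_ulift, Nat.card_zmod]
  have hle := (h (ULift.{w} (ZMod (max m 1))) (by
    rw [ENat.card_eq_coe_natCard, hA]
    exact_mod_cast le_max_left m 1)).card_le hK
  rw [hA, hcard] at hle
  omega

end SimpleGraph

theorem mainTheorem2 {V : Type u} [Fintype V] (G : SimpleGraph V) [DecidableRel G.Adj]
    (hG : G.IsPlanar) (d : ℕ) (hd : 3 ≤ d) (hdG : d ≤ G.maxDegree)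
    (hgirth : ((4 + ⌈(8 : ℚ) / ((d : ℚ) - 2)⌉₊ : ℕ) : ℕ∞) ≤ G.egirth) :
    SimpleGraph.groupEdgeChromaticNumber.{u, w} G = (G.maxDegree : ℕ∞) ∧
      SimpleGraph.groupEdgeChoiceNumber.{u, w} G = (G.maxDegree : ℕ∞) := by
  classical
  -- Multiply out: `4(d - 2) + 8 = 4d`.
  have hgd : 4 * d ≤ (4 + ⌈(8 : ℚ) / ((d : ℚ) - 2)⌉₊) * (d - 2) := by
    have hpos : (0 : ℚ) < (d : ℚ) - 2 := by
      have : (3 : ℚ) ≤ d := by exact_mod_cast hd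
      linarith
    have h := Nat.le_ceil ((8 : ℚ) / ((d : ℚ) - 2))
    rw [div_le_iff₀ hpos] at h
    generalize ⌈(8 : ℚ) / ((d : ℚ) - 2)⌉₊ = c at h
    have hc : ((d - 2 : ℕ) : ℚ) = (d : ℚ) - 2 := by
      rw [Nat.cast_sub (by omega), Nat.cast_two]
    rw [← hc] at h
    have h' : 8 ≤ c * (d - 2) := by exact_mod_cast h
    rw [add_mul]
    omega
  have hchoose : SimpleGraph.IsGroupChoosable.{u, w} G.lineGraph G.maxDegree :=
    SimpleGraph.isGroupChoosable_of_degenerate _ _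
      (SimpleGraph.card_lineGraph_neighbors_lt hG hd hdG hgd hgirth)
  have hcolor := fun (A : Type w) [AddCommGroup A] (hA : (G.maxDegree : ℕ∞) ≤ ENat.card A) =>
    hchoose.isGroupColorable A hA
  constructor
  · refine le_antisymm (iInf₂_le G.maxDegree hcolor) (le_iInf₂ fun m hm => ?_)
    exact_mod_cast G.maxDegree_le_of_forall_isGroupColorable (by omega) m hm
  · refine le_antisymm (iInf₂_le G.maxDegree hchoose) (le_iInf₂ fun m hm => ?_)
    exact_mod_cast G.maxDegree_le_of_forall_isGroupColorable (by omega) m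
      fun A _ hA => SimpleGraph.IsGroupChoosable.isGroupColorable hm A hA
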